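/- Work in the ring $\mathcal R=\mathrm{GF}(2)[x,x^{-1},y,y^{-1}]$ and identify the monomial $x^iy^j$ with the cell centered at $(i,j)\in\mathbb Z^2$. An element $F\in\mathcal R$ is a neighborhood: it lists the finitely many cells that form the neighborhood of the origin, and the neighborhood of the cell $x^ry^s$ is the translate $x^ry^sF$. The odd-rule cellular automaton of $F$ starts at generation $0$ with only the cell at the origin ON; a cell is ON at generation $m+1$ if and only if it belongs to the neighborhoods of an odd number of the cells that are ON at generation $m$. Let $a_m(F)$ be the number of ON cells at generation $m$, and let $b_n(F)=a_{2^n-1}(F)$. Call $F$ a height-one neighborhood if $|i|\le 1$ and $|j|\le 1$ for every monomial $x^iy^j$ in $F$. Two neighborhoods are trivially equivalent if one can be carried to the other by repeated translations, rotations by right angles, and reflections (the symmetries of the square lattice). Odd-rule $365$ is the neighborhood $$F_{365}=\frac1{xy}+\frac1x+\frac xy+1+y+xy .$$ **Theorem.** Let $F$ be a height-one neighborhood. Then for every $n\ge 4$ $$b_n(F)\le 3\cdot 4^n-2\cdot 3^n ,$$ and, for each such $n$, equality holds if and only if $F$ is trivially equivalent to $F_{365}$. Hence Odd-rule $365$ is,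 up to trivial equivalence, the unique fastest-growing rule: if $F$ is a height-one neighborhood that is not trivially equivalent to $F_{365}$, then $b_n(F)<b_n(F_{365})$ for all $n\ge4$. -/

import Mathlib

/-! Two-dimensional odd-rule cellular automata on `ℤ × ℤ`. The cell centred at `(i, j)` is identified
with the monomial `x ^ i * y ^ j`. -/

namespace OddRule

/-- The ring `GF(2)[x, x⁻¹, y, y⁻¹]` of Laurent polynomials in two variables over the field with two
elements: the exponent pair `(i, j)` stands for the monomial `x ^ i * y ^ j`. -/
abbrev Laurent : Type := AddMonoidAlgebra (ZMod 2) (ℤ × ℤ)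

/-- The monomial `x ^ i * y ^ j`, where `c = (i, j)`. -/
noncomputable def mono (c : ℤ × ℤ) : Laurent := AddMonoidAlgebra.single c 1

/-- The finite set of cells listed by a Laurent polynomial, that is, the exponents of its monomials. -/
def cells (F : Laurent) : Finset (ℤ × ℤ) := F.coeff.support

/-- The height of `F`: the maximum of `|i|` and `|j|` over the monomials `x ^ i * y ^ j` in `F`
(zero if `F = 0`). -/
def height (F : Laurent) : ℕ := (cells F).sup fun c => max c.1.natAbs c.2.natAbs

/-- One step of the odd-rule automaton with neighborhood `F`. The neighborhood of the cell `d` is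
`d + cells F`, so the cell `c` lies in it exactly when `c - d ∈ cells F`. The cell `c` is ON in the
new generation exactly when it lies in the neighborhood of an odd number of cells of `S`. Only cells
lying in at least one of these neighborhoods can qualify, so the filter runs over these;
see `mem_step`. -/
def step (F : Laurent) (S : Finset (ℤ × ℤ)) : Finset (ℤ × ℤ) :=
  ((S ×ˢ cells F).image fun p => p.1 + p.2).filter fun c =>
    Odd (S.filter fun d => c - d ∈ cells F).card

theorem mem_step (F : Laurent) (S : Finset (ℤ × ℤ)) (c : ℤ × ℤ) :
    c ∈ step F S ↔ Odd (S.filter fun d => c - d ∈ cells F).card := by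
  unfold step
  rw [Finset.mem_filter, and_iff_right_iff_imp]
  intro h
  obtain ⟨d, hd⟩ := Finset.card_pos.mp h.pos
  rw [Finset.mem_filter] at hd
  exact Finset.mem_image.mpr ⟨(d, c - d), Finset.mem_product.mpr hd, by simp⟩

/-- The set of ON cells at generation `n`, when only the cell at the origin is ON at generation `0`. -/
def state (F : Laurent) : ℕ → Finset (ℤ × ℤ)
  | 0 => {0}
  | n + 1 => step F (state F n)

/-- `a_n(F)`: the number of ON cells at generation `n`. -/
def a (F : Laurent) (n : ℕ) : ℕ := (state F n).card

/-- `b_n(F)`: the number of ON cells at generation `2 ^ n - 1`. -/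
def b (F : Laurent) (n : ℕ) : ℕ := a F (2 ^ n - 1)

/-- The translate of `F` by the vector `v`, that is, the product of `F` with a monomial. -/
noncomputable def translate (v : ℤ × ℤ) (F : Laurent) : Laurent := mono v * F

/-- The rotation of `F` about the origin by a right angle. -/
noncomputable def rotate (F : Laurent) : Laurent :=
  AddMonoidAlgebra.mapDomain (fun c : ℤ × ℤ => (-c.2, c.1)) F

/-- The reflection of `F` in the vertical axis. Together with `rotate` it generates the eight
symmetries of the square. -/
noncomputable def reflect (F : Laurent) : Laurent :=
  AddMonoidAlgebra.mapDomain (fun c : ℤ × ℤ => (-c.1, c.2)) F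

/-- `G` arises from `F` by a single translation, rotation by a right angle, or reflection. -/
def Move (F G : Laurent) : Prop :=
  (∃ v, G = translate v F) ∨ G = rotate F ∨ G = reflect F

/-- Trivial equivalence: one neighborhood can be carried to the other by repeated translations,
rotations and reflections. -/
def TriviallyEquivalent (F G : Laurent) : Prop := Relation.ReflTransGen Move F G

/-- The neighborhood with Odd-rule number `d₁ d₂ d₃` (three octal digits): the ON cells of the
`3 × 3` grid are read from left to right, top to bottom. So `d₁`, `d₂`, `d₃` encode the rows
`j = 1`, `j = 0`, `j = -1`, and within a row the bits of values `4`, `2`, `1` encode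
the columns `i = -1`, `i = 0`, `i = 1`. -/
noncomputable def rule (d₁ d₂ d₃ : Fin 8) : Laurent :=
  ∑ r : Fin 3, ∑ k : Fin 3,
    if (![d₁, d₂, d₃] r : ℕ).testBit (2 - (k : ℕ)) then mono ((k : ℤ) - 1, 1 - (r : ℤ)) else 0

/-- Odd-rule 365 is `y + x * y + 1 / x + 1 + 1 / (x * y) + x / y`. -/
theorem rule_365 : rule 3 6 5 =
    mono (0, 1) + mono (1, 1) + mono (-1, 0) + mono (0, 0) + mono (-1, -1) + mono (1, -1) := by
  simp [rule, Fin.sum_univ_three, Nat.testBit, add_assoc]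

end OddRule

/-!
Generation `m` of the automaton is the set of monomials of `F ^ m` (`state_eq_cells_pow`), so
`b F n` counts the monomials of `F ^ (2 ^ n - 1)`. Put `G = F ^ (2 ^ n - 1)`. Over `GF(2)` one has
`F ^ (2 ^ (n + 1) - 1) = F * G(x ^ 2, y ^ 2)`. Sorting the exponents of `P * F` by their parities
writes `P * F` as the sum of `x ^ i * y ^ j * P_ij(x ^ 2, y ^ 2)` with `i, j ∈ {0, 1}`, and no two
of the four products `x ^ i * y ^ j * (P_ij * G)(x ^ 2, y ^ 2)` have a monomial in common. Hence
the number of monomials of `P * F ^ (2 ^ (n + 1) - 1)` is the sum of those of the four products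
`P_ij * F ^ (2 ^ n - 1)`. If the exponents of `F` lie in `{0, 1, 2}`, as may be assumed after a
translation, and those of `P` lie in `{0, 1}`, then those of `P_ij` lie in `{0, 1}` again. So for
each `F` the sixteen numbers belonging to the polynomials `P` with exponents in `{0, 1}` obey a
linear recurrence with four terms (`count_succ`).

For Odd-rule 365 three of these sixteen numbers form a closed system, whose solution consists of
`3 * 4 ^ n - 2 * 3 ^ n` (twice) and `3 * 4 ^ n` (`count_365`). For every neighborhood other than
Odd-rule 365 and its rotations, some table of the recurrence with `4 ≤ n ≤ 9` is already so small
that the trivial growth factor `4` per step keeps the count for `P = 1` below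
`3 * 4 ^ n - 2 * 3 ^ n` ever after (`count_lt_of_weight`): the bound itself grows by a factor of
more than `4` per step. Finding these tables is a finite computation over the 512 neighborhoods
(`check_all`). Its numbers are packed into single natural numbers, so that the kernel can do the
arithmetic on numerals.
-/

namespace OddRule

/-! ### The automaton as powers of a Laurent polynomial -/

theorem zmod_eq_one : ∀ r : ZMod 2, r ≠ 0 → r = 1 := by decide

theorem step_cells (F A : Laurent) : step F (cells A) = cells (A * F) := by
  ext c
  have key : (A * F).coeff c = (((cells A).filter fun d => c - d ∈ cells F).card : ZMod 2) := by
    rw [AddMonoidAlgebra.coeff_mul, Finsupp.sum, Finset.card_filter, Nat.cast_sum]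
    refine Finset.sum_congr rfl fun d hd => ?_
    have hA : A.coeff d = 1 := zmod_eq_one _ (Finsupp.mem_support_iff.mp hd)
    have h : ∀ e, (d + e = c ↔ e = c - d) := fun e => by rw [eq_sub_iff_add_eq, add_comm]
    simp only [h, hA, one_mul, Finsupp.sum_ite_eq']
    split_ifs with h1 h2 h2
    · simp [zmod_eq_one _ (Finsupp.mem_support_iff.mp h1)]
    · exact absurd h1 h2
    · exact absurd h2 h1
    · simp
  rw [mem_step, show c ∈ cells (A * F) ↔ (A * F).coeff c ≠ 0 from Finsupp.mem_support_iff, key,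
    ZMod.natCast_ne_zero_iff_odd]

/-- Generation `n` of the automaton consists of the monomials of `F ^ n`. -/
theorem state_eq_cells_pow (F : Laurent) (n : ℕ) : state F n = cells (F ^ n) := by
  induction n with
  | zero => simp [state, cells, AddMonoidAlgebra.one_def]
  | succ n ih => rw [state, ih, step_cells, pow_succ]

theorem b_eq (F : Laurent) (n : ℕ) : b F n = (cells (F ^ (2 ^ n - 1))).card := by
  rw [b, a, state_eq_cells_pow]

/-! ### Invariance under the symmetries of the lattice -/

theorem mono_mul_mono (v w : ℤ × ℤ) : mono v * mono w = mono (v + w) := by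
  simp [mono, AddMonoidAlgebra.single_mul_single]

theorem mono_pow (v : ℤ × ℤ) (n : ℕ) : mono v ^ n = mono (n • v) := by
  simp [mono, AddMonoidAlgebra.single_pow]

theorem cells_mapDomain {f : ℤ × ℤ → ℤ × ℤ} (hf : Function.Injective f) (A : Laurent) :
    cells (AddMonoidAlgebra.mapDomain f A) = (cells A).image f :=
  Finsupp.mapDomain_support_of_injective hf _

theorem mono_mul_eq_mapDomain (v : ℤ × ℤ) (A : Laurent) :
    mono v * A = AddMonoidAlgebra.mapDomain (v + ·) A := by
  induction A using AddMonoidAlgebra.induction_linear with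
  | zero => simp
  | add f g hf hg => rw [mul_add, hf, hg, AddMonoidAlgebra.mapDomain_add]
  | single c r => simp [mono, AddMonoidAlgebra.single_mul_single]

theorem cells_mono_mul (v : ℤ × ℤ) (A : Laurent) :
    cells (mono v * A) = (cells A).image (v + ·) := by
  rw [mono_mul_eq_mapDomain, cells_mapDomain (add_right_injective v)]

theorem card_cells_mono_mul (v : ℤ × ℤ) (A : Laurent) :
    (cells (mono v * A)).card = (cells A).card := by
  rw [cells_mono_mul, Finset.card_image_of_injective _ (add_right_injective v)]

theorem b_translate (v : ℤ × ℤ) (F : Laurent) (n : ℕ) : b (translate v F) n = b F n := by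
  rw [b_eq, b_eq, translate, mul_pow, mono_pow, card_cells_mono_mul]

theorem b_mapDomain (f : ℤ × ℤ →+ ℤ × ℤ) (hf : Function.Injective f) (F : Laurent) (n : ℕ) :
    b (AddMonoidAlgebra.mapDomain f F) n = b F n := by
  have h : AddMonoidAlgebra.mapDomain f F ^ (2 ^ n - 1) =
      AddMonoidAlgebra.mapDomain f (F ^ (2 ^ n - 1)) :=
    (map_pow (AddMonoidAlgebra.mapDomainRingHom (ZMod 2) f) F _).symm
  rw [b_eq, b_eq, h, cells_mapDomain hf, Finset.card_image_of_injective _ hf]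

theorem b_rotate (F : Laurent) (n : ℕ) : b (rotate F) n = b F n :=
  b_mapDomain ⟨⟨fun c => (-c.2, c.1), by simp⟩, fun c d => by ext <;> simp [add_comm]⟩
    (fun c d h => by simp_all [Prod.ext_iff]) F n

theorem b_reflect (F : Laurent) (n : ℕ) : b (reflect F) n = b F n :=
  b_mapDomain ⟨⟨fun c => (-c.1, c.2), by simp⟩, fun c d => by ext <;> simp [add_comm]⟩
    (fun c d h => by simp_all [Prod.ext_iff]) F n

theorem TriviallyEquivalent.b_eq {F G : Laurent} (h : TriviallyEquivalent F G) (n : ℕ) :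
    b F n = b G n := by
  induction h with
  | refl => rfl
  | tail _ hm ih =>
    rcases hm with ⟨v, rfl⟩ | rfl | rfl
    · rw [ih, b_translate]
    · rw [ih, b_rotate]
    · rw [ih, b_reflect]

/-! ### Splitting exponents by parity -/

/-- The substitution `x ↦ x ^ 2`, `y ↦ y ^ 2`. -/
noncomputable def dilate : Laurent →+* Laurent :=
  AddMonoidAlgebra.mapDomainRingHom (ZMod 2) (nsmulAddMonoidHom (α := ℤ × ℤ) 2)

theorem two_eq_zero : (2 : Laurent) = 0 := by
  have : (2 : Laurent) = algebraMap (ZMod 2) Laurent 2 :=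
    (map_ofNat (algebraMap (ZMod 2) Laurent) 2).symm
  rw [this, show (2 : ZMod 2) = 0 from rfl, map_zero]

/-- Squaring is the Frobenius map of `GF(2)[x, x⁻¹, y, y⁻¹]`; it fixes the coefficients and
doubles the exponents. -/
theorem dilate_apply (A : Laurent) : dilate A = A ^ 2 := by
  induction A using AddMonoidAlgebra.induction_linear with
  | zero => simp
  | add f g hf hg => rw [map_add, hf, hg, add_sq, two_eq_zero]; ring
  | single c r =>
    have : r ^ 2 = r := by revert r; decide
    simp [dilate, AddMonoidAlgebra.single_pow, this]

theorem cells_mono_mul_dilate (v : ℤ × ℤ) (A : Laurent) :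
    cells (mono v * dilate A) = (cells A).image fun c => v + 2 • c := by
  have h : Function.Injective (nsmulAddMonoidHom (α := ℤ × ℤ) 2) := fun c d h => by
    simpa [Prod.ext_iff] using h
  rw [cells_mono_mul, dilate]
  change ((cells (AddMonoidAlgebra.mapDomain _ A)).image _) = _
  rw [cells_mapDomain h, Finset.image_image]
  rfl

theorem card_cells_add {A B : Laurent} (h : Disjoint (cells A) (cells B)) :
    (cells (A + B)).card = (cells A).card + (cells B).card := by
  rw [← Finset.card_union_of_disjoint h]
  congr 1
  exact Finsupp.support_add_eq h

theorem cells_add_subset (A B : Laurent) : cells (A + B) ⊆ cells A ∪ cells B :=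
  Finsupp.support_add

/-- No cancellation takes place between the four residue classes of exponents modulo `2`. -/
theorem card_cells_parity (A B C D : Laurent) :
    (cells (dilate A + mono (1, 0) * dilate B + mono (0, 1) * dilate C +
      mono (1, 1) * dilate D)).card =
      (cells A).card + (cells B).card + (cells C).card + (cells D).card := by
  have hA : dilate A = mono 0 * dilate A := by
    rw [show mono 0 = 1 from rfl, one_mul]
  have hcard : ∀ (v : ℤ × ℤ) (E : Laurent), (cells (mono v * dilate E)).card = (cells E).card := by
    intro v E
    rw [cells_mono_mul_dilate, Finset.card_image_of_injective]
    intro c d h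
    simpa [Prod.ext_iff] using h
  have hpar : ∀ (v : ℤ × ℤ) (E : Laurent), ∀ c ∈ cells (mono v * dilate E),
      c.1 % 2 = v.1 % 2 ∧ c.2 % 2 = v.2 % 2 := by
    intro v E c hc
    rw [cells_mono_mul_dilate, Finset.mem_image] at hc
    obtain ⟨d, -, rfl⟩ := hc
    simp
  rw [hA, card_cells_add, card_cells_add, card_cells_add, hcard, hcard, hcard, hcard]
  · rw [Finset.disjoint_left]
    intro c h1 h2
    have h1 := hpar _ _ c h1
    have h2 := hpar _ _ c h2
    simp at h1 h2
    omega
  · rw [Finset.disjoint_left]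
    intro c h1 h2
    have h2 := hpar _ _ c h2
    rcases Finset.mem_union.mp (cells_add_subset _ _ h1) with h1 | h1 <;>
    · have h1 := hpar _ _ c h1
      simp at h1 h2
      omega
  · rw [Finset.disjoint_left]
    intro c h1 h2
    have h2 := hpar _ _ c h2
    rcases Finset.mem_union.mp (cells_add_subset _ _ h1) with h1 | h1
    on_goal 1 => rcases Finset.mem_union.mp (cells_add_subset _ _ h1) with h1 | h1
    all_goals
      have h1 := hpar _ _ c h1
      simp at h1 h2
      omega

/-! ### Blocks and the counting recurrence -/

/-- A coefficient in `GF(2)`, given as a Boolean, as a constant Laurent polynomial. -/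
noncomputable def bit (p : Bool) : Laurent := if p then 1 else 0

theorem bit_xor (p q : Bool) : bit (p ^^ q) = bit p + bit q := by
  cases p <;> cases q <;> simp [bit, one_add_one_eq_two, two_eq_zero]

theorem dilate_bit (p : Bool) : dilate (bit p) = bit p := by
  cases p <;> simp [bit]

theorem card_cells_bit (p : Bool) : (cells (bit p)).card = p.toNat := by
  cases p <;> simp [bit, cells, AddMonoidAlgebra.one_def]

/-- The polynomial with monomials among `1, x, y, xy` listed by the bits `0, 1, 2, 3` of `k`. -/
noncomputable def block (k : ℕ) : Laurent :=
  bit (k.testBit 0) + mono (1, 0) * bit (k.testBit 1) + mono (0, 1) * bit (k.testBit 2) +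
    mono (1, 1) * bit (k.testBit 3)

theorem block_xor (k l : ℕ) : block (k ^^^ l) = block k + block l := by
  simp only [block, Nat.testBit_xor, bit_xor]
  ring

theorem block_zero : block 0 = 0 := by simp [block, bit]

theorem block_one : block 1 = 1 := by
  simp [block, bit, Nat.testBit]

theorem card_cells_block (k : ℕ) : (cells (block k)).card =
    (k.testBit 0).toNat + (k.testBit 1).toNat + (k.testBit 2).toNat + (k.testBit 3).toNat := by
  have h := card_cells_parity (bit (k.testBit 0)) (bit (k.testBit 1)) (bit (k.testBit 2))
    (bit (k.testBit 3))
  simp only [dilate_bit, card_cells_bit] at h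
  exact h

/-- The height-one neighborhood with Odd-rule number `m` (usually written in octal), translated by
`(1, 1)` so that all exponents lie in `{0, 1, 2}`. -/
noncomputable def corner (m : ℕ) : Laurent :=
  mono (0, 2) * bit (m.testBit 8) + mono (1, 2) * bit (m.testBit 7) +
    mono (2, 2) * bit (m.testBit 6) + mono (0, 1) * bit (m.testBit 5) +
    mono (1, 1) * bit (m.testBit 4) + mono (2, 1) * bit (m.testBit 3) +
    bit (m.testBit 2) + mono (1, 0) * bit (m.testBit 1) + mono (2, 0) * bit (m.testBit 0)

/-- The number whose bits `0, 1, 2, 3` are `p, q, r, s`. -/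
def ofBits (p q r s : Bool) : ℕ := p.toNat + 2 * q.toNat + 4 * r.toNat + 8 * s.toNat

theorem block_ofBits (p q r s : Bool) : block (ofBits p q r s) =
    bit p + mono (1, 0) * bit q + mono (0, 1) * bit r + mono (1, 1) * bit s := by
  cases p <;> cases q <;> cases r <;> cases s <;> rfl

/-- An additive map from blocks to blocks, given by the images of `1, x, y, xy`. -/
structure BlockMap where
  (one x y xy : ℕ)

/-- The images of the blocks `0, …, 15`: block `k` is the sum of the basis elements selected by
the bits of `k`, and addition of blocks is bitwise exclusive or. -/
def BlockMap.images (r : BlockMap) : List ℕ :=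
  [0, r.one, r.x, r.x ^^^ r.one, r.y, r.y ^^^ r.one, r.y ^^^ r.x, r.y ^^^ (r.x ^^^ r.one),
    r.xy, r.xy ^^^ r.one, r.xy ^^^ r.x, r.xy ^^^ (r.x ^^^ r.one), r.xy ^^^ r.y,
    r.xy ^^^ (r.y ^^^ r.one), r.xy ^^^ (r.y ^^^ r.x), r.xy ^^^ (r.y ^^^ (r.x ^^^ r.one))]

/-- The image of the block `k`. -/
def BlockMap.apply (r : BlockMap) (k : ℕ) : ℕ := r.images.getD k 0

theorem BlockMap.block_apply (r : BlockMap) {k : ℕ} (hk : k < 16) : block (r.apply k) =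
    bit (k.testBit 0) * block r.one + bit (k.testBit 1) * block r.x +
      bit (k.testBit 2) * block r.y + bit (k.testBit 3) * block r.xy := by
  interval_cases k <;>
    simp [BlockMap.apply, BlockMap.images, block_xor, block_zero, bit, Nat.testBit] <;> ring

/-- Four maps on blocks, one for each parity class of exponents (`e` for even, `o` for odd, first
`x` and then `y`). -/
structure Parts where
  (ee oe eo oo : BlockMap)

/-- The parity parts of multiplication by `corner m`: the map indexed by the class of `(i, j)`
modulo `2`, where `i, j ∈ {0, 1}`, sends `P` to the block `Q` for which
`x ^ i * y ^ j * Q(x ^ 2, y ^ 2)` collects the monomials of `P * corner m` in that class; see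
`block_mul_corner`. -/
def parts (m : ℕ) : Parts :=
  let f := m.testBit
  { ee :=
      { one := ofBits (f 2) (f 0) (f 8) (f 6)
        x := ofBits false (f 1) false (f 7)
        y := ofBits false false (f 5) (f 3)
        xy := ofBits false false false (f 4) }
    oe :=
      { one := ofBits (f 1) false (f 7) false
        x := ofBits (f 2) (f 0) (f 8) (f 6)
        y := ofBits false false (f 4) false
        xy := ofBits false false (f 5) (f 3) }
    eo :=
      { one := ofBits (f 5) (f 3) false false
        x := ofBits false (f 4) false false
        y := ofBits (f 2) (f 0) (f 8) (f 6)
        xy := ofBits false (f 1) false (f 7) }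
    oo :=
      { one := ofBits (f 4) false false false
        x := ofBits (f 5) (f 3) false false
        y := ofBits (f 1) false (f 7) false
        xy := ofBits (f 2) (f 0) (f 8) (f 6) } }

theorem block_mul_corner (m : ℕ) {k : ℕ} (hk : k < 16) : block k * corner m =
    dilate (block ((parts m).ee.apply k)) + mono (1, 0) * dilate (block ((parts m).oe.apply k)) +
      mono (0, 1) * dilate (block ((parts m).eo.apply k)) +
      mono (1, 1) * dilate (block ((parts m).oo.apply k)) := by
  have h11 : mono (1, 1) = mono (1, 0) * mono (0, 1) := by simp [mono_mul_mono]
  have h20 : mono (2, 0) = mono (1, 0) ^ 2 := by simp [mono_pow]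
  have h02 : mono (0, 2) = mono (0, 1) ^ 2 := by simp [mono_pow]
  have h21 : mono (2, 1) = mono (1, 0) ^ 2 * mono (0, 1) := by simp [mono_mul_mono, mono_pow]
  have h12 : mono (1, 2) = mono (1, 0) * mono (0, 1) ^ 2 := by simp [mono_mul_mono, mono_pow]
  have h22 : mono (2, 2) = mono (1, 0) ^ 2 * mono (0, 1) ^ 2 := by simp [mono_mul_mono, mono_pow]
  have hX : dilate (mono (1, 0)) = mono (1, 0) ^ 2 := dilate_apply _
  have hY : dilate (mono (0, 1)) = mono (0, 1) ^ 2 := dilate_apply _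
  have h0 : bit false = 0 := rfl
  simp only [BlockMap.block_apply _ hk, parts, block_ofBits, map_add, map_mul, dilate_bit, h11,
    hX, hY, h0, map_zero]
  simp only [block, corner, h11, h20, h02, h21, h12, h22]
  ring

/-- The number of monomials of `block k * corner m ^ (2 ^ n - 1)`. -/
noncomputable def count (m n k : ℕ) : ℕ := (cells (block k * corner m ^ (2 ^ n - 1))).card

/-- Since `2 ^ (n + 1) - 1 = 2 * (2 ^ n - 1) + 1`, a block times `corner m ^ (2 ^ (n + 1) - 1)` is
the block times `corner m`, multiplied by a power dilated by `2`. The parity parts of the first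
product are again blocks, so the sixteen counts satisfy a linear recurrence. -/
theorem count_succ (m n : ℕ) {k : ℕ} (hk : k < 16) : count m (n + 1) k =
    count m n ((parts m).ee.apply k) + count m n ((parts m).oe.apply k) +
      count m n ((parts m).eo.apply k) + count m n ((parts m).oo.apply k) := by
  have hexp : 2 ^ (n + 1) - 1 = (2 ^ n - 1) * 2 + 1 := by
    have := Nat.one_le_two_pow (n := n)
    omega
  have h : block k * corner m ^ (2 ^ (n + 1) - 1) =
      block k * corner m * dilate (corner m ^ (2 ^ n - 1)) := by
    rw [dilate_apply, hexp, pow_succ, pow_mul]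
    ring
  rw [count, h, block_mul_corner m hk]
  simp only [count, ← card_cells_parity, map_mul]
  congr 2
  ring

theorem count_zero_right (m n : ℕ) : count m n 0 = 0 := by
  simp [count, block_zero, cells]

theorem count_zero (m k : ℕ) : count m 0 k =
    (k.testBit 0).toNat + (k.testBit 1).toNat + (k.testBit 2).toNat + (k.testBit 3).toNat := by
  simp [count, card_cells_block]

theorem count_one (m n : ℕ) : count m n 1 = b (corner m) n := by
  simp [count, block_one, b_eq]

theorem ofBits_lt (p q r s : Bool) : ofBits p q r s < 16 := by
  cases p <;> cases q <;> cases r <;> cases s <;> decide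

/-- All four images are blocks. -/
def BlockMap.Valid (r : BlockMap) : Prop := r.one < 16 ∧ r.x < 16 ∧ r.y < 16 ∧ r.xy < 16

theorem BlockMap.Valid.apply_lt {r : BlockMap} (h : r.Valid) (k : ℕ) : r.apply k < 16 := by
  obtain ⟨h1, h2, h3, h4⟩ := h
  have hx : ∀ {a b : ℕ}, a < 16 → b < 16 → a ^^^ b < 16 := fun {a b} ha hb =>
    Nat.xor_lt_two_pow (n := 4) ha hb
  by_cases hk : k < 16
  · interval_cases k <;>
      simp only [BlockMap.apply, BlockMap.images, List.getD_cons_zero, List.getD_cons_succ] <;>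
      repeat' first | assumption | apply hx
  · rw [BlockMap.apply, List.getD_eq_default _ _ (by simpa [BlockMap.images] using hk)]
    norm_num

theorem parts_valid (m : ℕ) : (parts m).ee.Valid ∧ (parts m).oe.Valid ∧ (parts m).eo.Valid ∧
    (parts m).oo.Valid := by
  simp [parts, BlockMap.Valid, ofBits_lt]

/-! ### Certified bounds for all neighborhoods -/

/-- Evaluates `k n`. Matching on `n` makes kernel reduction compute `n` to a numeral before it is
substituted into `k`. -/
def force {α : Type} (n : ℕ) (k : ℕ → α) : α := match n with
  | 0 => k 0
  | m + 1 => k (m + 1)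

theorem force_eq {α : Type} (n : ℕ) (k : ℕ → α) : force n k = k n := by cases n <;> rfl

/-- `force` applied to the four images of a block map. -/
def BlockMap.force {α : Type} (r : BlockMap) (k : BlockMap → α) : α :=
  OddRule.force r.one fun a => OddRule.force r.x fun b => OddRule.force r.y fun c =>
    OddRule.force r.xy fun d => k ⟨a, b, c, d⟩

theorem BlockMap.force_eq {α : Type} (r : BlockMap) (k : BlockMap → α) : r.force k = k r := by
  simp [BlockMap.force, OddRule.force_eq]

/-- The number with the given base `2 ^ 32` digits, least significant first. -/
def pack : List ℕ → ℕ
  | [] => 0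
  | x :: xs => x + 2 ^ 32 * pack xs

/-- The base `2 ^ 32` digit of `V` with index `k`. -/
def get (V k : ℕ) : ℕ := V / 2 ^ (32 * k) % 2 ^ 32

theorem get_pack (l : List ℕ) (hl : ∀ x ∈ l, x < 2 ^ 32) (k : ℕ) : get (pack l) k = l.getD k 0 := by
  induction l generalizing k with
  | nil => simp [pack, get]
  | cons x xs ih =>
    have hx := hl x (by simp)
    cases k with
    | zero => simpa [get, pack, Nat.add_mul_mod_self_left] using hx
    | succ k =>
      have := ih (fun y hy => hl y (by simp [hy])) k
      rw [List.getD_cons_succ, ← this, get, get, pack, Nat.mul_succ, add_comm (32 * k), pow_add,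
        ← Nat.div_div_eq_div_mul, Nat.add_mul_div_left _ _ (by positivity), Nat.div_eq_of_lt hx,
        zero_add]

/-- Adds up the digits of `V` with indices at equal positions in four lists. -/
def sums (V : ℕ) : List ℕ → List ℕ → List ℕ → List ℕ → List ℕ
  | a :: as, b :: bs, c :: cs, d :: ds =>
    (get V a + get V b + get V c + get V d) :: sums V as bs cs ds
  | _, _, _, _ => []

theorem sums_length (V : ℕ) : ∀ {a b c d : List ℕ} {N : ℕ}, a.length = N → b.length = N →
    c.length = N → d.length = N → (sums V a b c d).length = N
  | [], _, _, _, _, h, _, _, _ => by simpa [sums] using h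
  | a :: as, b :: bs, c :: cs, d :: ds, N + 1, h, h1, h2, h3 => by
    simp only [List.length_cons, add_left_inj] at h h1 h2 h3
    simp [sums, sums_length V h h1 h2 h3]

theorem sums_getD (V : ℕ) : ∀ {a b c d : List ℕ} {N k : ℕ}, k < N → a.length = N → b.length = N →
    c.length = N → d.length = N → (sums V a b c d).getD k 0 =
      get V (a.getD k 0) + get V (b.getD k 0) + get V (c.getD k 0) + get V (d.getD k 0)
  | [], _, _, _, N, k, hk, h, _, _, _ => by simp only [List.length_nil] at h; omega
  | a :: as, b :: bs, c :: cs, d :: ds, N + 1, 0, _, _, _, _, _ => by simp [sums]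
  | a :: as, b :: bs, c :: cs, d :: ds, N + 1, k + 1, hk, h, h1, h2, h3 => by
    simp only [List.length_cons, add_left_inj, add_lt_add_iff_right] at hk h h1 h2 h3
    simpa [sums] using sums_getD V hk h h1 h2 h3

/-- One step of the recurrence `count_succ`, on the packed table of all sixteen values. -/
def Parts.next (S : Parts) (V : ℕ) : ℕ :=
  pack (sums V S.ee.images S.oe.images S.eo.images S.oo.images)

/-- The value `3 * 4 ^ n - 2 * 3 ^ n` attained by Odd-rule 365. -/
def target (n : ℕ) : ℕ := 3 * 4 ^ n - 2 * 3 ^ n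

theorem cast_target (n : ℕ) : (target n : ℤ) = 3 * 4 ^ n - 2 * 3 ^ n := by
  have : 3 ^ n ≤ 4 ^ n := Nat.pow_le_pow_left (by norm_num) n
  rw [target, Nat.cast_sub (by omega)]
  push_cast
  ring

theorem four_pow_mul_target_le (n j : ℕ) : 4 ^ j * target n ≤ target (n + j) := by
  have h : (3 : ℤ) ^ j ≤ 4 ^ j := pow_le_pow_left₀ (by norm_num) (by norm_num) j
  have h3 : (0 : ℤ) < 3 ^ n := by positivity
  zify
  rw [cast_target, cast_target, pow_add, pow_add]
  nlinarith

/-- The number of nonzero parity parts of the neighborhood itself. -/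
def Parts.weight (S : Parts) : ℕ :=
  min S.ee.one 1 + min S.oe.one 1 + min S.eo.one 1 + min S.oo.one 1

/-- Whether `w` times each of the first digits of `V`, as many as the last argument says, is less
than `B`. -/
def allBelow (w V B : ℕ) : ℕ → Bool
  | 0 => true
  | k + 1 => Nat.blt (w * get V k) B && allBelow w V B k

theorem allBelow_spec {w V B : ℕ} : ∀ {k : ℕ}, allBelow w V B k = true → ∀ i < k, w * get V i < B
  | 0, _, i, hi => by simp at hi
  | k + 1, h, i, hi => by
    simp only [allBelow, Bool.and_eq_true, Nat.blt_eq] at h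
    rcases Nat.lt_succ_iff_lt_or_eq.mp hi with hi | rfl
    · exact allBelow_spec h.2 i hi
    · exact h.1

/-- Given the packed table `V` of generation `2 ^ n - 1`, checks the strict bound for the block
`1` at `n`, and then looks for a table from which the bound follows for all later generations
(`count_lt_of_weight`), taking at most `fuel` tables. -/
def search (S : Parts) : ℕ → ℕ → ℕ → Bool
  | 0, _, _ => false
  | fuel + 1, n, V => Nat.blt (get V 1) (target n) &&
      (allBelow S.weight V (target (n + 1)) 16 || force (S.next V) (search S fuel (n + 1)))

/-- The digits of `V` are the values `count m n k` for `k < 16`. -/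
def Encodes (m n V : ℕ) : Prop := ∀ k < 16, get V k = count m n k

/-- This bound ensures that the values with `n ≤ 14` fit into the digits of a packed table. -/
theorem count_le (m n : ℕ) {k : ℕ} (hk : k < 16) : count m n k ≤ 4 ^ (n + 1) := by
  induction n generalizing k with
  | zero =>
    rw [count_zero]
    have := (k.testBit 0).toNat_le
    have := (k.testBit 1).toNat_le
    have := (k.testBit 2).toNat_le
    have := (k.testBit 3).toNat_le
    omega
  | succ n ih =>
    obtain ⟨h1, h2, h3, h4⟩ := parts_valid m
    rw [count_succ m n hk, pow_succ 4 (n + 1)]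
    have := ih (h1.apply_lt k)
    have := ih (h2.apply_lt k)
    have := ih (h3.apply_lt k)
    have := ih (h4.apply_lt k)
    omega

theorem Encodes.next {m n V : ℕ} (h : Encodes m n V) (hn : n < 14) :
    Encodes m (n + 1) ((parts m).next V) := by
  obtain ⟨h1, h2, h3, h4⟩ := parts_valid m
  have hlen : ∀ {r : BlockMap}, r.images.length = 16 := rfl
  have hval : ∀ k < 16, (sums V (parts m).ee.images (parts m).oe.images (parts m).eo.images
      (parts m).oo.images).getD k 0 = count m (n + 1) k := by
    intro k hk
    rw [sums_getD V hk hlen hlen hlen hlen, count_succ m n hk]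
    simp only [← BlockMap.apply.eq_1]
    rw [h _ (h1.apply_lt k), h _ (h2.apply_lt k), h _ (h3.apply_lt k), h _ (h4.apply_lt k)]
  intro k hk
  rw [Parts.next, get_pack _ _ k, hval k hk]
  -- The remaining goal is that no digit overflows.
  intro x hx
  obtain ⟨i, hi, rfl⟩ := List.getElem_of_mem hx
  have hi' : i < 16 := by
    rwa [sums_length V hlen hlen hlen hlen] at hi
  rw [← List.getD_eq_getElem _ 0 hi, hval i hi']
  calc count m (n + 1) i ≤ 4 ^ (n + 2) := count_le m _ hi'
    _ ≤ 4 ^ 15 := Nat.pow_le_pow_right (by norm_num) (by omega)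
    _ < 2 ^ 32 := by norm_num

/-- Each step multiplies the largest count by at most `4`, and the first step, starting from the
block `1`, only by the number of nonzero parity parts of the neighborhood. The gain in the first
step is needed for `1 + x ^ 2 + y ^ 2 + x ^ 2 * y ^ 2`: its counts are `4 ^ n` for the block `1`,
but `4 * 4 ^ n` for the block `1 + x + y + x * y`, which exceeds `3 * 4 ^ n`. -/
theorem count_lt_of_weight {m n B : ℕ} (h : ∀ k < 16, (parts m).weight * count m n k < B) (j : ℕ) :
    count m (n + j + 1) 1 < 4 ^ j * B := by
  obtain ⟨h1, h2, h3, h4⟩ := parts_valid m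
  have hw : ∀ k < 16, (parts m).weight * count m (n + j) k < 4 ^ j * B := by
    induction j with
    | zero => simpa using h
    | succ j ih =>
      intro k hk
      rw [← add_assoc, count_succ m _ hk, pow_succ]
      have := ih _ (h1.apply_lt k)
      have := ih _ (h2.apply_lt k)
      have := ih _ (h3.apply_lt k)
      have := ih _ (h4.apply_lt k)
      linarith
  obtain ⟨K, hK, hmax⟩ := Finset.exists_max_image (Finset.range 16) (count m (n + j)) ⟨0, by simp⟩
  have hmin : ∀ k < 16, count m (n + j) k ≤ min k 1 * count m (n + j) K := by
    intro k hk
    rcases k.eq_zero_or_pos with rfl | hpos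
    · simp [count_zero_right]
    · have hk1 : min k 1 = 1 := by omega
      rw [hk1, one_mul]
      exact hmax k (Finset.mem_range.mpr hk)
  rw [count_succ m _ (by norm_num)]
  refine lt_of_le_of_lt ?_ (hw K (Finset.mem_range.mp hK))
  simp only [Parts.weight, add_mul]
  exact Nat.add_le_add (Nat.add_le_add (Nat.add_le_add (hmin _ h1.1) (hmin _ h2.1)) (hmin _ h3.1))
    (hmin _ h4.1)

theorem search_spec {m : ℕ} : ∀ {fuel n V : ℕ}, Encodes m n V → n + fuel ≤ 14 →
    search (parts m) fuel n V = true → ∀ i ≥ n, count m i 1 < target i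
  | 0, n, V, _, _, h, _, _ => by simp [search] at h
  | fuel + 1, n, V, hV, hn, h, i, hi => by
    simp only [search, force_eq, Bool.and_eq_true, Bool.or_eq_true, Nat.blt_eq] at h
    rcases hi.eq_or_lt with rfl | hi
    · rw [← hV 1 (by norm_num)]
      exact h.1
    · rcases h.2 with h2 | h2
      · have h3 := allBelow_spec h2
        have := count_lt_of_weight (m := m) (n := n) (B := target (n + 1))
          (fun k hk => hV k hk ▸ h3 k hk) (i - (n + 1))
        have h4 := four_pow_mul_target_le (n + 1) (i - (n + 1))
        rw [show n + (i - (n + 1)) + 1 = i by omega] at this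
        rw [show n + 1 + (i - (n + 1)) = i by omega] at h4
        exact this.trans_le h4
      · exact search_spec (hV.next (by omega)) (by omega) h2 i hi

/-- Computes the tables for `n = 0, …, 4` and searches from there on. The initial table lists the
sizes of the sixteen blocks. -/
def check (S : Parts) : Bool :=
  S.ee.force fun ee => S.oe.force fun oe => S.eo.force fun eo => S.oo.force fun oo =>
    let S : Parts := ⟨ee, oe, eo, oo⟩
    force (pack [0, 1, 1, 2, 1, 2, 2, 3, 1, 2, 2, 3, 2, 3, 3, 4]) fun V =>
    force (S.next V) fun V => force (S.next V) fun V => force (S.next V) fun V =>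
    force (S.next V) fun V => search S 6 4 V

theorem check_spec {m : ℕ} (h : check (parts m) = true) {n : ℕ} (hn : 4 ≤ n) :
    count m n 1 < target n := by
  have h0 : Encodes m 0 (pack [0, 1, 1, 2, 1, 2, 2, 3, 1, 2, 2, 3, 2, 3, 3, 4]) := by
    intro k hk
    rw [get_pack _ (by simp), count_zero]
    interval_cases k <;> rfl
  simp only [check, BlockMap.force_eq, force_eq] at h
  exact search_spec ((((h0.next (by norm_num)).next (by norm_num)).next (by norm_num)).next
    (by norm_num)) (by norm_num) h n hn

/-- The four exceptions are the rotations of Odd-rule 365. -/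
theorem check_all : ∀ m < 512, m ∈ [0o365, 0o536, 0o563, 0o635] ∨ check (parts m) = true := by
  decide +kernel

/-! ### Odd-rule numbers of height-one neighborhoods -/

theorem cells_subset_of_height {F : Laurent} (hF : height F ≤ 1) {c : ℤ × ℤ} (hc : c ∈ cells F) :
    -1 ≤ c.1 ∧ c.1 ≤ 1 ∧ -1 ≤ c.2 ∧ c.2 ≤ 1 := by
  have h : max c.1.natAbs c.2.natAbs ≤ 1 :=
    (Finset.le_sup (f := fun c : ℤ × ℤ => max c.1.natAbs c.2.natAbs) hc).trans hF
  rw [max_le_iff] at h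
  omega

theorem sum_cells_mono (F : Laurent) : ∑ c ∈ cells F, mono c = F := by
  conv_rhs => rw [← AddMonoidAlgebra.sum_coeff_single F]
  refine Finset.sum_congr rfl fun c hc => ?_
  rw [mono, zmod_eq_one _ (Finsupp.mem_support_iff.mp hc)]

/-- Every height-one neighborhood has an Odd-rule number. -/
theorem exists_corner {F : Laurent} (hF : height F ≤ 1) :
    ∃ m < 512, F = translate (-1, -1) (corner m) := by
  -- Bit `t` belongs to column `1 - t % 3` and row `t / 3 - 1`.
  let f : Fin 9 → Bool := fun t => decide ((1 - ((t : ℕ) : ℤ) % 3, ((t : ℕ) : ℤ) / 3 - 1) ∈ cells F)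
  refine ⟨Nat.ofBits f, Nat.ofBits_lt_two_pow f, ?_⟩
  have hf : ∀ t (ht : t < 9), bit ((Nat.ofBits f).testBit t) =
      if (1 - (t : ℤ) % 3, (t : ℤ) / 3 - 1) ∈ cells F then 1 else 0 := by
    intro t ht
    rw [Nat.testBit_ofBits_lt f t ht]
    simp [bit, f]
  have hsub : cells F ⊆ ({-1, 0, 1} : Finset ℤ) ×ˢ ({-1, 0, 1} : Finset ℤ) := by
    intro c hc
    have := cells_subset_of_height hF hc
    simp only [Finset.mem_product, Finset.mem_insert, Finset.mem_singleton]
    omega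
  have hsum : F = ∑ c ∈ ({-1, 0, 1} : Finset ℤ) ×ˢ ({-1, 0, 1} : Finset ℤ),
      mono c * if c ∈ cells F then 1 else 0 := by
    conv_lhs => rw [← sum_cells_mono F]
    simp only [mul_ite, mul_one, mul_zero]
    rw [← Finset.sum_filter, Finset.filter_mem_eq_inter, Finset.inter_eq_right.mpr hsub]
  conv_lhs => rw [hsum]
  rw [translate, corner, hf 0 (by norm_num), hf 1 (by norm_num), hf 2 (by norm_num),
    hf 3 (by norm_num), hf 4 (by norm_num), hf 5 (by norm_num), hf 6 (by norm_num),
    hf 7 (by norm_num), hf 8 (by norm_num)]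
  rw [Finset.sum_product]
  simp only [mul_add, ← mul_assoc, mono_mul_mono]
  norm_num
  ring

/-! ### Odd-rule 365 and its rotations -/

theorem rule_365_eq_translate_corner : rule 3 6 5 = translate (-1, -1) (corner 0o365) := by
  rw [rule_365]
  simp [corner, translate, bit, Nat.testBit, mono_mul_mono, mul_add]

theorem rotate_mono (c : ℤ × ℤ) : rotate (mono c) = mono (-c.2, c.1) := by
  simp [rotate, mono]

theorem rotate_add (F G : Laurent) : rotate (F + G) = rotate F + rotate G :=
  AddMonoidAlgebra.mapDomain_add _ _ _

theorem rotate_635 : rotate (translate (-1, -1) (corner 0o635)) = rule 3 6 5 := by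
  rw [rule_365]
  simp [corner, translate, bit, Nat.testBit, mono_mul_mono, mul_add, rotate_add, rotate_mono]
  abel

theorem rotate_536 : rotate (translate (-1, -1) (corner 0o536)) =
    translate (-1, -1) (corner 0o635) := by
  simp [corner, translate, bit, Nat.testBit, mono_mul_mono, mul_add, rotate_add, rotate_mono]
  abel

theorem rotate_563 : rotate (translate (-1, -1) (corner 0o563)) =
    translate (-1, -1) (corner 0o536) := by
  simp [corner, translate, bit, Nat.testBit, mono_mul_mono, mul_add, rotate_add, rotate_mono]
  abel

theorem triviallyEquivalent_365 {m : ℕ} (hm : m ∈ [0o365, 0o536, 0o563, 0o635]) :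
    TriviallyEquivalent (translate (-1, -1) (corner m)) (rule 3 6 5) := by
  have h1 : TriviallyEquivalent (translate (-1, -1) (corner 0o635)) (rule 3 6 5) :=
    .single (.inr (.inl rotate_635.symm))
  have h2 : TriviallyEquivalent (translate (-1, -1) (corner 0o536)) (rule 3 6 5) :=
    .head (.inr (.inl rotate_536.symm)) h1
  simp only [List.mem_cons, List.not_mem_nil, or_false] at hm
  rcases hm with rfl | rfl | rfl | rfl
  · rw [← rule_365_eq_translate_corner]
    exact .refl
  · exact h2
  · exact .head (.inr (.inl rotate_563.symm)) h2
  · exact h1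

/-- For Odd-rule 365 the blocks `1`, `y` and `1 + x + x * y`, with numbers `1`, `4` and `11`, span
a closed part of the recurrence. -/
theorem count_365 (n : ℕ) : (count 0o365 n 1 : ℤ) = 3 * 4 ^ n - 2 * 3 ^ n ∧
    (count 0o365 n 4 : ℤ) = 3 * 4 ^ n - 2 * 3 ^ n ∧ (count 0o365 n 11 : ℤ) = 3 * 4 ^ n := by
  induction n with
  | zero => simp [count_zero, Nat.testBit]
  | succ n ih =>
    obtain ⟨h1, h4, h11⟩ := ih
    -- The parity parts of these three blocks times the neighborhood.
    have hone : ((parts 0o365).ee.apply 1, (parts 0o365).oe.apply 1, (parts 0o365).eo.apply 1,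
        (parts 0o365).oo.apply 1) = (11, 4, 1, 1) := by decide
    have hy : ((parts 0o365).ee.apply 4, (parts 0o365).oe.apply 4, (parts 0o365).eo.apply 4,
        (parts 0o365).oo.apply 4) = (4, 4, 11, 4) := by decide
    have htri : ((parts 0o365).ee.apply 11, (parts 0o365).oe.apply 11,
        (parts 0o365).eo.apply 11, (parts 0o365).oo.apply 11) = (11, 11, 11, 11) := by decide
    simp only [Prod.mk.injEq] at hone hy htri
    refine ⟨?_, ?_, ?_⟩ <;> rw [count_succ _ _ (by norm_num)]
    · rw [hone.1, hone.2.1, hone.2.2.1, hone.2.2.2]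
      push_cast
      rw [h1, h4, h11]
      ring
    · rw [hy.1, hy.2.1, hy.2.2.1, hy.2.2.2]
      push_cast
      rw [h4, h11]
      ring
    · rw [htri.1, htri.2.1, htri.2.2.1, htri.2.2.2]
      push_cast
      rw [h11]
      ring

theorem b_365 (n : ℕ) : (b (rule 3 6 5) n : ℤ) = 3 * 4 ^ n - 2 * 3 ^ n := by
  rw [rule_365_eq_translate_corner, b_translate, ← count_one]
  exact (count_365 n).1

/-! ### The growth bound -/

theorem b_lt_or_triviallyEquivalent {F : Laurent} (hF : height F ≤ 1) {n : ℕ} (hn : 4 ≤ n) :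
    (b F n : ℤ) < 3 * 4 ^ n - 2 * 3 ^ n ∨ TriviallyEquivalent F (rule 3 6 5) := by
  obtain ⟨m, hm, rfl⟩ := exists_corner hF
  rcases check_all m hm with h | h
  · exact .inr (triviallyEquivalent_365 h)
  · left
    rw [b_translate, ← count_one, ← cast_target]
    exact_mod_cast check_spec h hn

end OddRule

theorem mainTheorem2 (F : OddRule.Laurent) (hF : OddRule.height F ≤ 1) (n : ℕ) (hn : 4 ≤ n) :
    (OddRule.b F n : ℤ) ≤ 3 * 4 ^ n - 2 * 3 ^ n ∧
    ((OddRule.b F n : ℤ) = 3 * 4 ^ n - 2 * 3 ^ n ↔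
      OddRule.TriviallyEquivalent F (OddRule.rule 3 6 5)) ∧
    (¬ OddRule.TriviallyEquivalent F (OddRule.rule 3 6 5) →
      OddRule.b F n < OddRule.b (OddRule.rule 3 6 5) n) := by
  have heq : OddRule.TriviallyEquivalent F (OddRule.rule 3 6 5) →
      (OddRule.b F n : ℤ) = 3 * 4 ^ n - 2 * 3 ^ n := fun h => by
    rw [h.b_eq, OddRule.b_365]
  have hlt := OddRule.b_lt_or_triviallyEquivalent hF hn
  refine ⟨hlt.elim le_of_lt fun h => (heq h).le,
    ⟨fun h => hlt.resolve_left h.not_lt, heq⟩, fun h => ?_⟩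
  have := hlt.resolve_right h
  rw [← OddRule.b_365] at this
  exact_mod_cast this
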